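/- A vincular pattern of length $k$ is a pair $(\sigma,X)$ with $\sigma$ a permutation of $[k]=\{1,\dots,k\}$ and $X\subseteq[k-1]$. It is written as the word $\sigma_1\sigma_2\cdots\sigma_k$ with a dash between $\sigma_j$ and $\sigma_{j+1}$ whenever $j\notin X$. A permutation $\pi=\pi_1\cdots\pi_n$ of $[n]$ contains $(\sigma,X)$ if there are indices $1\le i_1<i_2<\cdots<i_k\le n$ such that $\pi_{i_1}\pi_{i_2}\cdots\pi_{i_k}$ is order-isomorphic to $\sigma$ and $i_{j+1}=i_j+1$ for every $j\in X$; otherwise $\pi$ avoids it. Two vincular patterns are Wilf-equivalent, written $\equiv$, if for every $n\ge 0$ they are avoided by the same number of permutations of $[n]$. **Theorem.** $31\text{-}2\text{-}4\equiv 13\text{-}2\text{-}4$ and $14\text{-}2\text{-}3\equiv 41\text{-}2\text{-}3$. -/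

import Mathlib

/-- A vincular pattern `(σ, X)`: a permutation `σ` of length `k` together with a set
`X ⊆ {1, …, k - 1}` of adjacencies (positions are counted from one in `X`). -/
structure VincularPattern where
  /-- The length `k` of the pattern. -/
  length : ℕ
  /-- The underlying permutation, in one-line notation `σ 0, σ 1, …` with letters `0, …, k - 1`. -/
  perm : Equiv.Perm (Fin length)
  /-- The set of adjacencies. -/
  adj : Finset ℕ
  adj_subset : adj ⊆ Finset.Icc 1 (length - 1)

namespace VincularPattern

/-- The subsequence of `π` at the positions `i 0 < i 1 < … < i (k - 1)` is a copy of the pattern: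
it is order-isomorphic to `σ`, and for every adjacency `j` in `X` the `j`-th and
`(j + 1)`-st chosen positions (counted from one) are consecutive. -/
def IsOccurrence (p : VincularPattern) {n : ℕ} (π : Equiv.Perm (Fin n))
    (i : Fin p.length → Fin n) : Prop :=
  StrictMono i ∧
  (∀ a b : Fin p.length, π (i a) < π (i b) ↔ p.perm a < p.perm b) ∧
  (∀ a b : Fin p.length, (b : ℕ) = (a : ℕ) + 1 → (a : ℕ) + 1 ∈ p.adj →
    (i b : ℕ) = (i a : ℕ) + 1)

/-- `π` contains the pattern `p`. -/
def ContainedIn (p : VincularPattern) {n : ℕ} (π : Equiv.Perm (Fin n)) : Prop :=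
  ∃ i : Fin p.length → Fin n, p.IsOccurrence π i

/-- The set of permutations of length `n` that avoid `p`. -/
def avoiders (n : ℕ) (p : VincularPattern) : Set (Equiv.Perm (Fin n)) :=
  {π | ¬ p.ContainedIn π}

/-- Two vincular patterns are Wilf-equivalent if, for every `n ≥ 0`, they are avoided by the same
number of permutations of length `n`. -/
def WilfEquiv (p q : VincularPattern) : Prop :=
  ∀ n : ℕ, (avoiders n p).ncard = (avoiders n q).ncard

/-- The pattern 31-2-4. -/
def p31_2_4 : VincularPattern where
  length := 4
  perm := ⟨![2, 0, 1, 3], ![1, 2, 0, 3], by decide, by decide⟩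
  adj := {1}
  adj_subset := by decide

/-- The pattern 13-2-4. -/
def p13_2_4 : VincularPattern where
  length := 4
  perm := ⟨![0, 2, 1, 3], ![0, 2, 1, 3], by decide, by decide⟩
  adj := {1}
  adj_subset := by decide

/-- The pattern 14-2-3. -/
def p14_2_3 : VincularPattern where
  length := 4
  perm := ⟨![0, 3, 1, 2], ![0, 2, 3, 1], by decide, by decide⟩
  adj := {1}
  adj_subset := by decide

/-- The pattern 41-2-3. -/
def p41_2_3 : VincularPattern where
  length := 4
  perm := ⟨![3, 0, 1, 2], ![1, 2, 3, 0], by decide, by decide⟩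
  adj := {1}
  adj_subset := by decide

end VincularPattern

/-! By inclusion–exclusion it suffices, for every set `S` of positions, to match the permutations in
which each `i ∈ S` starts an occurrence of the ascent pattern with those where each starts one of
the descent pattern. Link `i` to `i + 1` for `i ∈ S`. The word is monotone on each block of linked
positions, so reversing every block turns the prescribed ascents into descents and conversely. The
reversal depends only on `S` and is an involution, hence a bijection. An occurrence survives if its
last two letters lie in distinct blocks, both after the block of its first two, since order between
blocks is kept. The third letter leaves the first block because its value lies strictly between the
first two. That the last two letters can be separated is `Separable`: inside a shared block, which
must be increasing, another occurrence starting there supplies a replacement letter. -/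

/-! ### Blocks of linked positions and their reversal. -/

/-- `Linked T p q`: all positions in `[p, q)` belong to `T`. -/
def Linked (T : ℕ → Prop) (p q : ℕ) : Prop := ∀ m, p ≤ m → m < q → T m

/-- `[a, b]` is a maximal interval of positions linked by `T`. -/
def IsBlock (T : ℕ → Prop) (a b : ℕ) : Prop :=
  Linked T a b ∧ ¬ T b ∧ ∀ m, m + 1 = a → ¬ T m

lemma IsBlock.eq {T : ℕ → Prop} {a b a' b' p : ℕ} (h : IsBlock T a b) (h' : IsBlock T a' b')
    (ha : a ≤ p) (hb : p ≤ b) (ha' : a' ≤ p) (hb' : p ≤ b') : a = a' ∧ b = b' := by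
  obtain ⟨h1, h2, h3⟩ := h
  obtain ⟨h1', h2', h3'⟩ := h'
  refine ⟨?_, ?_⟩
  · rcases lt_trichotomy a a' with hlt | heq | hlt
    · exact absurd (h1 (a' - 1) (by omega) (by omega)) (h3' _ (by omega))
    · exact heq
    · exact absurd (h1' (a - 1) (by omega) (by omega)) (h3 _ (by omega))
  · rcases lt_trichotomy b b' with hlt | heq | hlt
    · exact absurd (h1' b (by omega) hlt) h2
    · exact heq
    · exact absurd (h1 b' (by omega) hlt) h2'

lemma exists_isBlock {T : ℕ → Prop} {n : ℕ} (hT : ∀ m, T m → m + 1 < n) (p : ℕ) :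
    ∃ a b, a ≤ p ∧ p ≤ b ∧ IsBlock T a b := by
  classical
  have hlo : ∃ a, a ≤ p ∧ Linked T a p ∧ ∀ m, m + 1 = a → ¬ T m := by
    induction p with
    | zero => exact ⟨0, le_rfl, fun m _ h => by omega, fun m h => by omega⟩
    | succ p ih =>
      by_cases hp : T p
      · obtain ⟨a, h1, h2, h3⟩ := ih
        refine ⟨a, by omega, fun m hm hm' => ?_, h3⟩
        rcases Nat.lt_succ_iff_lt_or_eq.mp hm' with h | rfl
        · exact h2 m hm h
        · exact hp
      · refine ⟨p + 1, le_rfl, fun m _ _ => by omega, fun m hm => ?_⟩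
        obtain rfl : m = p := by omega
        exact hp
  have hhi : ∃ b, p ≤ b ∧ ¬ T b := ⟨p + n, by omega, fun h => by have := hT _ h; omega⟩
  obtain ⟨a, h1, h2, h3⟩ := hlo
  obtain ⟨hb1, hb2⟩ := Nat.find_spec hhi
  refine ⟨a, Nat.find hhi, h1, hb1, fun m hm hm' => ?_, hb2, h3⟩
  by_cases hmp : m < p
  · exact h2 m hm hmp
  · by_contra hc
    exact Nat.find_min hhi hm' ⟨by omega, hc⟩

/-- There is an involution of the positions that reverses each block of linked positions. -/
lemma exists_block_reversal {T : ℕ → Prop} {n : ℕ} (hT : ∀ m, T m → m + 1 < n) :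
    ∃ ρ : Equiv.Perm (Fin n), (∀ p, ρ (ρ p) = p) ∧
      (∀ p q : Fin n, (q : ℕ) = p + 1 → T p → (ρ p : ℕ) = ρ q + 1 ∧ T (ρ q)) ∧
      (∀ p q : Fin n, p < q → ¬ Linked T p q → ρ p < ρ q) := by
  choose lo hi hlo hhi hB using exists_isBlock hT
  have hn : ∀ p, p < n → hi p < n := fun p hp => by
    rcases (hhi p).eq_or_lt with h | h
    · omega
    · have := hT _ ((hB p).1 (hi p - 1) (by have := hlo p; omega) (by omega))
      omega
  have key : ∀ p q, lo p ≤ q → q ≤ hi p → lo q = lo p ∧ hi q = hi p := fun p q h1 h2 =>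
    (hB q).eq (hB p) (hlo q) (hhi q) h1 h2
  -- Reflection of the block of `p`; by `key` its endpoints are the same for all points of the
  -- block.
  let r : Fin n → Fin n := fun p => ⟨lo p + hi p - p, by
    have := hn p p.2; have := hlo p; omega⟩
  have hr : Function.Involutive r := fun p => by
    have h1 := hlo p
    have h2 := hhi p
    obtain ⟨h3, h4⟩ := key p (lo p + hi p - p) (by omega) (by omega)
    apply Fin.ext
    simp only [r, h3, h4]
    omega
  refine ⟨hr.toPerm, hr, fun p q hpq hp => ?_, fun p q hpq hL => ?_⟩
  · have h0 : (p : ℕ) + 1 ≤ hi p := by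
      by_contra hc
      have : hi p = p := by have := hhi p; omega
      exact (hB p).2.1 (this.symm ▸ hp)
    have h1 := hlo p
    obtain ⟨h3, h4⟩ := key p q (by omega) (by omega)
    have h5 : ((r q : Fin n) : ℕ) = lo p + hi p - q := by simp only [r, h3, h4]
    have h6 : ((r p : Fin n) : ℕ) = lo p + hi p - p := rfl
    change (r p : ℕ) = r q + 1 ∧ T (r q)
    rw [h5, h6]
    exact ⟨by omega, (hB p).1 _ (by omega) (by omega)⟩
  · have hpq' : (p : ℕ) < q := hpq
    have h1 := hlo p
    have h2 := hhi q
    have h3 : hi p < q := by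
      by_contra hc
      exact hL fun m hm hm' => (hB p).1 m (by omega) (by omega)
    have h4 : hi p < lo q := by
      by_contra hc
      have := (key q (hi p) (by omega) (by omega)).2
      have := (key p (hi p) (by have := hhi p; omega) le_rfl).2
      omega
    change lo p + hi p - p < lo q + hi q - q
    omega

/-! ### Occurrences by starting position; monotone blocks. -/

/-- The positions `a`, `b` are the positions `i`, `i + 1`, in this order if `up` holds and in the
opposite order otherwise. -/
def Consecutive {n : ℕ} (up : Bool) (i a b : Fin n) : Prop :=
  if up then a = i ∧ (b : ℕ) = i + 1 else b = i ∧ (a : ℕ) = i + 1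

/-- The letters of `π` at the positions `i`, `i + 1` form an ascent (if `up` holds) or a descent
which extends, with two later letters, to values `x < y`, `u`, `v` with `P x y u v`. -/
def StartsAt {n : ℕ} (P : Fin n → Fin n → Fin n → Fin n → Prop) (up : Bool)
    (π : Equiv.Perm (Fin n)) (i : Fin n) : Prop :=
  ∃ a b k l : Fin n, Consecutive up i a b ∧ a < k ∧ b < k ∧ k < l ∧ π a < π b ∧
    P (π a) (π b) (π k) (π l)

/-- A set of positions, as a predicate on the natural numbers that holds for positions other than
the last one only. -/
def IsLink {n : ℕ} (S : Finset (Fin n)) (m : ℕ) : Prop := m + 1 < n ∧ ∃ i ∈ S, (i : ℕ) = m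

lemma Linked.lt {n : ℕ} {P : Fin n → Fin n → Fin n → Fin n → Prop} {up : Bool}
    {π : Equiv.Perm (Fin n)} {S : Finset (Fin n)} (hS : ∀ i ∈ S, StartsAt P up π i)
    {p q : Fin n} (hpq : p < q) (h : Linked (IsLink S) p q) :
    if up then π p < π q else π q < π p := by
  obtain ⟨q, hq⟩ := q
  induction q with
  | zero => exact absurd hpq (Nat.not_lt_zero _)
  | succ q ih =>
    have hp : (p : ℕ) < q + 1 := hpq
    obtain ⟨-, i, hi, hiq⟩ := h q (by omega) (by simp)
    have hstep : if up then π i < π ⟨q + 1, hq⟩ else π ⟨q + 1, hq⟩ < π i := by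
      obtain ⟨a, b, k, l, hc, -, -, -, hab, -⟩ := hS i hi
      cases up
      · simp only [Consecutive, Bool.false_eq_true, if_false] at hc ⊢
        obtain ⟨rfl, hb⟩ := hc
        rwa [show (⟨q + 1, hq⟩ : Fin n) = a from Fin.ext (by simp; omega)]
      · simp only [Consecutive, if_true] at hc ⊢
        obtain ⟨rfl, hb⟩ := hc
        rwa [show (⟨q + 1, hq⟩ : Fin n) = b from Fin.ext (by simp; omega)]
    have hiq' : i = ⟨q, by omega⟩ := Fin.ext hiq
    rcases Nat.lt_succ_iff_lt_or_eq.mp hp with hlt | heq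
    · have := ih (by omega) hlt (fun m hm hm' => h m hm (by simp at hm' ⊢; omega))
      cases up
      · simp only [Bool.false_eq_true, if_false, hiq'] at *
        exact hstep.trans this
      · simp only [if_true, hiq'] at *
        exact this.trans hstep
    · rwa [show p = i from Fin.ext (by omega)]

/-- An increasing chain of linked positions steps over every intermediate value. -/
lemma Linked.exists_step {n : ℕ} {π : Fin n → Fin n} {S : Finset (Fin n)} {y : Fin n}
    {p q : Fin n} (hpq : p ≤ q) (h : Linked (IsLink S) p q) (hp : π p < y) (hq : y < π q) :
    ∃ m m' : Fin n, m ∈ S ∧ p ≤ m ∧ m' ≤ q ∧ (m' : ℕ) = m + 1 ∧ π m ≤ y ∧ y < π m' := by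
  obtain ⟨q, hqn⟩ := q
  induction q with
  | zero =>
    obtain rfl : p = ⟨0, hqn⟩ := Fin.ext (Nat.le_zero.mp hpq)
    exact absurd (hp.trans hq) (lt_irrefl _)
  | succ q ih =>
    have hpq' : (p : ℕ) ≤ q + 1 := hpq
    rcases hpq'.eq_or_lt with heq | hlt
    · obtain rfl : p = ⟨q + 1, hqn⟩ := Fin.ext heq
      exact absurd (hp.trans hq) (lt_irrefl _)
    obtain ⟨-, i, hi, hiq⟩ := h q (by omega) (by simp)
    rw [show i = ⟨q, by omega⟩ from Fin.ext hiq] at hi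
    rcases le_or_gt (π ⟨q, by omega⟩) y with hle | hgt
    · exact ⟨_, _, hi, Nat.le_of_lt_succ hlt, le_rfl, rfl, hle, hq⟩
    · obtain ⟨m, m', h1, h2, h3, h4⟩ := ih (by omega) (Nat.le_of_lt_succ hlt)
        (fun m hm hm' => h m hm (by simp at hm' ⊢; omega)) hgt
      exact ⟨m, m', h1, h2, h3.trans (Nat.le_succ q), h4⟩

/-! ### Separating the last two letters of an occurrence. -/

/-- A condition `P x y u v` in which `u` lies between `x` and `y`, and such that two later letters
witnessing it can always be taken in distinct blocks of starting positions. -/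
def Separable {n : ℕ} (P : Fin n → Fin n → Fin n → Fin n → Prop) : Prop :=
  (∀ x y u v, P x y u v → x < u ∧ u < y) ∧
  ∀ (up : Bool) (π : Equiv.Perm (Fin n)) (S : Finset (Fin n)), (∀ i ∈ S, StartsAt P up π i) →
    ∀ (a b k l : Fin n), a < k → b < k → k < l → P (π a) (π b) (π k) (π l) →
      ∃ k' l', k ≤ k' ∧ k' < l' ∧ ¬ Linked (IsLink S) k' l' ∧ P (π a) (π b) (π k') (π l')

/-- In an occurrence starting at `m`, the third position is outside the block of `m`. -/
lemma Separable.not_linked {n : ℕ} {P : Fin n → Fin n → Fin n → Fin n → Prop}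
    (hP : ∀ x y u v, P x y u v → x < u ∧ u < y) {up : Bool}
    {π : Equiv.Perm (Fin n)} {S : Finset (Fin n)} (hS : ∀ i ∈ S, StartsAt P up π i)
    {a b k v : Fin n} (hak : a < k) (hbk : b < k) (h : P (π a) (π b) (π k) v) :
    (up = true → ¬ Linked (IsLink S) b k) ∧ (up = false → ¬ Linked (IsLink S) a k) := by
  obtain ⟨h1, h2⟩ := hP _ _ _ _ h
  refine ⟨?_, ?_⟩ <;> rintro rfl hL
  · have := hL.lt hS hbk
    simp only [if_true] at this
    exact absurd (this.trans h2) (lt_irrefl _)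
  · have := hL.lt hS hak
    simp only [Bool.false_eq_true, if_false] at this
    exact absurd (this.trans h1) (lt_irrefl _)

lemma separable_below {n : ℕ} :
    Separable (n := n) fun x y u v => x < u ∧ u < y ∧ y < v := by
  have hP : ∀ x y u v : Fin n, x < u ∧ u < y ∧ y < v → x < u ∧ u < y := fun _ _ _ _ h =>
    ⟨h.1, h.2.1⟩
  refine ⟨hP, fun up π S hS a b k l hak hbk hkl ⟨h1, h2, h3⟩ => ?_⟩
  by_cases hL : Linked (IsLink S) k l
  swap
  · exact ⟨k, l, le_rfl, hkl, hL, h1, h2, h3⟩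
  cases up
  · have := hL.lt hS hkl
    simp only [Bool.false_eq_true, if_false] at this
    exact absurd (this.trans (h2.trans h3)) (lt_irrefl _)
  -- The block climbs past `y = π b` between `m` and `m'`. Keep `m` as third letter and take the
  -- last letter of the occurrence starting at `m`: it exceeds `π m' > y`.
  obtain ⟨m, m', hm, hkm, hml, hm', h4, h5⟩ := hL.exists_step hkl.le h2 h3
  have h6 : π m < π b := lt_of_le_of_ne h4 fun h => by
    rw [π.injective h] at hkm
    exact absurd hbk (not_lt.mpr hkm)
  have hxm : π a < π m := by
    rcases hkm.eq_or_lt with rfl | hkm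
    · exact h1
    · have hml : (m' : ℕ) ≤ l := hml
      exact h1.trans (Linked.lt (p := k) (q := m) hS hkm fun j hj hj' => hL j hj (by omega))
  obtain ⟨a', b', k', l', hc, hak', hbk', hkl', hab', h7⟩ := hS m hm
  simp only [Consecutive, if_true] at hc
  obtain ⟨rfl, hb'⟩ := hc
  obtain rfl : b' = m' := Fin.ext (by omega)
  have hN := (Separable.not_linked hP hS hak' hbk' h7).1 rfl
  refine ⟨a', l', hkm, hak'.trans hkl', fun h => hN fun j hj hj' => h j ?_ ?_, hxm, h6,
    h5.trans h7.2.2⟩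
  · omega
  · exact hj'.trans hkl'

lemma separable_between {n : ℕ} :
    Separable (n := n) fun x y u v => x < u ∧ u < v ∧ v < y := by
  have hP : ∀ x y u v : Fin n, x < u ∧ u < v ∧ v < y → x < u ∧ u < y := fun _ _ _ _ h =>
    ⟨h.1, h.2.1.trans h.2.2⟩
  refine ⟨hP, fun up π S hS a b k l hak hbk hkl ⟨h1, h2, h3⟩ => ?_⟩
  by_cases hL : Linked (IsLink S) k l
  swap
  · exact ⟨k, l, le_rfl, hkl, hL, h1, h2, h3⟩
  cases up
  · have := hL.lt hS hkl
    simp only [Bool.false_eq_true, if_false] at this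
    exact absurd (this.trans h2) (lt_irrefl _)
  -- Being linked to `l`, the position `k` is in `S`. The third letter of its own occurrence
  -- replaces `π l`: its value is between `π k` and `π (k + 1) ≤ π l`.
  obtain ⟨-, i, hi, hik⟩ := hL k le_rfl hkl
  obtain rfl : i = k := Fin.ext hik
  obtain ⟨a', b', k', l', hc, hak', hbk', hkl', hab', h7⟩ := hS i hi
  simp only [Consecutive, if_true] at hc
  obtain ⟨rfl, hb'⟩ := hc
  have hN := (Separable.not_linked hP hS hak' hbk' h7).1 rfl
  have hbl : π b' ≤ π l := by
    have hkl' : (a' : ℕ) < l := hkl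
    rcases (show b' ≤ l from Fin.le_def.mpr (by omega)).eq_or_lt with rfl | hlt
    · exact le_rfl
    · have := Linked.lt hS hlt fun j hj hj' => hL j (by omega) hj'
      exact le_of_lt this
  exact ⟨a', k', le_rfl, hak', fun h => hN fun j hj hj' => h j (by omega) hj', h1, h7.1,
    (h7.2.1.trans h7.2.2).trans_le (hbl.trans h3.le)⟩

/-- The pair at `i, i + 1` in `π * ρ` is the reversed linked pair of `π` at `ρ (i + 1), ρ i`, so the
occurrence of `π` starting at `ρ (i + 1) ∈ S` is the one to transport. -/
lemma startsAt_mul_reversal {n : ℕ} {P : Fin n → Fin n → Fin n → Fin n → Prop}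
    (hP : Separable P) (up : Bool) {π ρ : Equiv.Perm (Fin n)} {S : Finset (Fin n)}
    (h1 : ∀ p, ρ (ρ p) = p)
    (h2 : ∀ p q : Fin n, (q : ℕ) = p + 1 → IsLink S p → (ρ p : ℕ) = ρ q + 1 ∧ IsLink S (ρ q))
    (h3 : ∀ p q : Fin n, p < q → ¬ Linked (IsLink S) p q → ρ p < ρ q)
    (hS : ∀ i ∈ S, StartsAt P up π i) : ∀ i ∈ S, StartsAt P (!up) (π * ρ) i := by
  intro i hi
  have hin : (i : ℕ) + 1 < n := by
    obtain ⟨a, b, -, -, hc, -⟩ := hS i hi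
    unfold Consecutive at hc
    split_ifs at hc
    · have := b.2; omega
    · have := a.2; omega
  obtain ⟨h4, -, q, hq, hqi⟩ := h2 i ⟨i + 1, hin⟩ rfl ⟨hin, i, hi, rfl⟩
  have hqi : q = ρ ⟨i + 1, hin⟩ := Fin.ext hqi
  obtain ⟨a, b, k, l, hc, hak, hbk, hkl, hab, hPk⟩ := hS q hq
  obtain ⟨k', l', hkk, hkl', hN', hPk'⟩ := hP.2 up π S hS a b k l hak hbk hkl hPk
  have hN := Separable.not_linked hP.1 hS (hak.trans_le hkk) (hbk.trans_le hkk) hPk'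
  have hak' := hak.trans_le hkk
  have hbk' := hbk.trans_le hkk
  have hNa : ¬ Linked (IsLink S) a k' ∧ ¬ Linked (IsLink S) b k' := by
    unfold Consecutive at hc
    cases up
    · simp only [Bool.false_eq_true, if_false] at hc
      have := hN.2 rfl
      exact ⟨this, fun h => this fun j hj hj' => h j (by rw [hc.1]; omega) hj'⟩
    · simp only [if_true] at hc
      have := hN.1 rfl
      exact ⟨fun h => this fun j hj hj' => h j (by rw [hc.1]; omega) hj', this⟩
  refine ⟨ρ a, ρ b, ρ k', ρ l', ?_, h3 _ _ hak' hNa.1, h3 _ _ hbk' hNa.2, h3 _ _ hkl' hN', ?_, ?_⟩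
  · unfold Consecutive at hc ⊢
    cases up
    · simp only [Bool.false_eq_true, if_false, Bool.not_false, if_true] at hc ⊢
      obtain ⟨rfl, ha⟩ := hc
      have : a = ρ i := Fin.ext (by rw [ha, h4, hqi])
      rw [this, hqi, h1, h1]
      exact ⟨rfl, rfl⟩
    · simp only [Bool.not_true, Bool.false_eq_true, if_false, if_true] at hc ⊢
      obtain ⟨rfl, hb⟩ := hc
      have : b = ρ i := Fin.ext (by rw [hb, h4, hqi])
      rw [this, hqi, h1, h1]
      exact ⟨rfl, rfl⟩
  · simpa [h1] using hab
  · simpa [h1] using hPk'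

/-! ### Counting by inclusion–exclusion. -/

open Classical in
/-- As many permutations have an occurrence with an ascent at each position of `S` as with a
descent. -/
lemma card_startsAt {n : ℕ} {P : Fin n → Fin n → Fin n → Fin n → Prop} (hP : Separable P)
    (S : Finset (Fin n)) :
    (Finset.univ.filter fun π => ∀ i ∈ S, StartsAt P true π i).card =
      (Finset.univ.filter fun π => ∀ i ∈ S, StartsAt P false π i).card := by
  obtain ⟨ρ, h1, h2, h3⟩ := exists_block_reversal (T := IsLink S) fun m h => h.1
  have hρ : ∀ π : Equiv.Perm (Fin n), π * ρ * ρ = π := fun π => by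
    refine Equiv.ext fun p => ?_
    simp [h1]
  refine Finset.card_bij' (fun π _ => π * ρ) (fun π _ => π * ρ) ?_ ?_ ?_ ?_
  · intro π h
    simp only [Finset.mem_filter, Finset.mem_univ, true_and] at h ⊢
    exact startsAt_mul_reversal hP true h1 h2 h3 h
  · intro π h
    simp only [Finset.mem_filter, Finset.mem_univ, true_and] at h ⊢
    exact startsAt_mul_reversal hP false h1 h2 h3 h
  · exact fun π _ => hρ π
  · exact fun π _ => hρ π

/-- Inclusion–exclusion: the number of elements outside all the sets of a family is determined by
the cardinalities of the intersections of its subfamilies. -/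
lemma card_forall_not_congr {ι α : Type*} [Fintype ι] [Fintype α] {A B : ι → α → Prop}
    (h : ∀ S : Finset ι, {x | ∀ i ∈ S, A i x}.ncard = {x | ∀ i ∈ S, B i x}.ncard) :
    {x | ∀ i, ¬ A i x}.ncard = {x | ∀ i, ¬ B i x}.ncard := by
  classical
  have key : ∀ C : ι → α → Prop, ({x | ∀ i, ¬ C i x}.ncard : ℤ) =
      ∑ t ∈ (Finset.univ : Finset ι).powerset, (-1) ^ t.card *
        ({x | ∀ i ∈ t, C i x}.ncard : ℤ) := by
    intro C
    have := Finset.inclusion_exclusion_card_inf_compl (Finset.univ : Finset ι)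
      fun i => Finset.univ.filter (C i)
    have h1 : {x | ∀ i, ¬ C i x}.ncard =
        (Finset.univ.inf fun i => (Finset.univ.filter (C i))ᶜ).card := by
      rw [← Set.ncard_coe_finset]
      congr 1
      ext x
      simp [Finset.mem_inf]
    have h2 : ∀ t : Finset ι, {x | ∀ i ∈ t, C i x}.ncard =
        (t.inf fun i => Finset.univ.filter (C i)).card := fun t => by
      rw [← Set.ncard_coe_finset]
      congr 1
      ext x
      simp [Finset.mem_inf]
    simpa only [h1, h2] using this
  have := key A
  simp only [h] at this
  rw [← key B] at this
  exact_mod_cast this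

lemma ncard_not_startsAt {n : ℕ} {P : Fin n → Fin n → Fin n → Fin n → Prop} (hP : Separable P) :
    {π | ∀ i, ¬ StartsAt P true π i}.ncard = {π | ∀ i, ¬ StartsAt P false π i}.ncard := by
  classical
  refine card_forall_not_congr (A := fun i π => StartsAt P true π i)
    (B := fun i π => StartsAt P false π i) fun S => ?_
  have := card_startsAt hP S
  rw [← Set.ncard_coe_finset, ← Set.ncard_coe_finset] at this
  simpa using this

/-! ### The four patterns in terms of starting positions. -/

namespace VincularPattern

/-- Occurrences of a pattern of length four whose only adjacency is the first one. -/
lemma containedIn_iff_of_length_four {n : ℕ} (σ : Equiv.Perm (Fin 4)) (h : {1} ⊆ Finset.Icc 1 3)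
    (π : Equiv.Perm (Fin n)) :
    (⟨4, σ, {1}, h⟩ : VincularPattern).ContainedIn π ↔
      ∃ a b k l : Fin n, (b : ℕ) = a + 1 ∧ b < k ∧ k < l ∧
        ∀ s : Fin 3, π (![a, b, k, l] (σ.symm s.castSucc)) < π (![a, b, k, l] (σ.symm s.succ)) := by
  constructor
  · rintro ⟨i, h1, h2, h3⟩
    change Fin 4 → Fin n at i
    have hi : ![i 0, i 1, i 2, i 3] = i := by
      funext s
      fin_cases s <;> rfl
    refine ⟨i 0, i 1, i 2, i 3, h3 (0 : Fin 4) (1 : Fin 4) rfl (by simp),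
      h1 (show (1 : Fin 4) < 2 by decide), h1 (show (2 : Fin 4) < 3 by decide), fun s => ?_⟩
    rw [hi]
    refine (h2 _ _).2 ?_
    simp
  · rintro ⟨a, b, k, l, hb, hbk, hkl, hlt⟩
    refine ⟨![a, b, k, l], ?_, ?_, ?_⟩
    · refine Fin.strictMono_iff_lt_succ (n := 3).2 fun j => ?_
      fin_cases j
      · exact Fin.lt_def.mpr (by simp; omega)
      · exact hbk
      · exact hkl
    · intro s t
      -- Listing the chosen letters by increasing pattern value reduces order-isomorphism to three
      -- consecutive inequalities.
      have := (Fin.strictMono_iff_lt_succ (n := 3)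
        (f := fun s => π (![a, b, k, l] (σ.symm s)))).2 hlt
      simpa using this.lt_iff_lt (a := σ s) (b := σ t)
    · intro s t hst hs
      change Fin 4 at s t
      obtain rfl : s = 0 := Fin.ext (by simpa using hs)
      obtain rfl : t = 1 := Fin.ext hst
      exact hb

lemma containedIn_p13_2_4_iff {n : ℕ} (π : Equiv.Perm (Fin n)) : p13_2_4.ContainedIn π ↔
    ∃ i, StartsAt (fun x y u v => x < u ∧ u < y ∧ y < v) true π i := by
  refine (containedIn_iff_of_length_four _ _ π).trans ⟨?_, ?_⟩
  · rintro ⟨a, b, k, l, hb, hbk, hkl, h⟩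
    have h1 := h 0
    have h2 := h 1
    have h3 := h 2
    exact ⟨a, a, b, k, l, ⟨rfl, hb⟩, (Fin.lt_def.mpr (by omega)).trans hbk, hbk, hkl,
      h1.trans h2, h1, h2, h3⟩
  · rintro ⟨i, a, b, k, l, ⟨rfl, hb⟩, hak, hbk, hkl, -, h1, h2, h3⟩
    refine ⟨a, b, k, l, hb, hbk, hkl, fun s => ?_⟩
    fin_cases s
    · exact h1
    · exact h2
    · exact h3

lemma containedIn_p31_2_4_iff {n : ℕ} (π : Equiv.Perm (Fin n)) : p31_2_4.ContainedIn π ↔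
    ∃ i, StartsAt (fun x y u v => x < u ∧ u < y ∧ y < v) false π i := by
  refine (containedIn_iff_of_length_four _ _ π).trans ⟨?_, ?_⟩
  · rintro ⟨a, b, k, l, hb, hbk, hkl, h⟩
    have h1 := h 0
    have h2 := h 1
    have h3 := h 2
    exact ⟨a, b, a, k, l, ⟨rfl, hb⟩, hbk, (Fin.lt_def.mpr (by omega)).trans hbk, hkl,
      h1.trans h2, h1, h2, h3⟩
  · rintro ⟨i, b, a, k, l, ⟨rfl, hb⟩, hbk, hak, hkl, -, h1, h2, h3⟩
    refine ⟨a, b, k, l, hb, hbk, hkl, fun s => ?_⟩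
    fin_cases s
    · exact h1
    · exact h2
    · exact h3

lemma containedIn_p14_2_3_iff {n : ℕ} (π : Equiv.Perm (Fin n)) : p14_2_3.ContainedIn π ↔
    ∃ i, StartsAt (fun x y u v => x < u ∧ u < v ∧ v < y) true π i := by
  refine (containedIn_iff_of_length_four _ _ π).trans ⟨?_, ?_⟩
  · rintro ⟨a, b, k, l, hb, hbk, hkl, h⟩
    have h1 := h 0
    have h2 := h 1
    have h3 := h 2
    exact ⟨a, a, b, k, l, ⟨rfl, hb⟩, (Fin.lt_def.mpr (by omega)).trans hbk, hbk, hkl,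
      h1.trans (h2.trans h3), h1, h2, h3⟩
  · rintro ⟨i, a, b, k, l, ⟨rfl, hb⟩, hak, hbk, hkl, -, h1, h2, h3⟩
    refine ⟨a, b, k, l, hb, hbk, hkl, fun s => ?_⟩
    fin_cases s
    · exact h1
    · exact h2
    · exact h3

lemma containedIn_p41_2_3_iff {n : ℕ} (π : Equiv.Perm (Fin n)) : p41_2_3.ContainedIn π ↔
    ∃ i, StartsAt (fun x y u v => x < u ∧ u < v ∧ v < y) false π i := by
  refine (containedIn_iff_of_length_four _ _ π).trans ⟨?_, ?_⟩
  · rintro ⟨a, b, k, l, hb, hbk, hkl, h⟩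
    have h1 := h 0
    have h2 := h 1
    have h3 := h 2
    exact ⟨a, b, a, k, l, ⟨rfl, hb⟩, hbk, (Fin.lt_def.mpr (by omega)).trans hbk, hkl,
      h1.trans (h2.trans h3), h1, h2, h3⟩
  · rintro ⟨i, b, a, k, l, ⟨rfl, hb⟩, hbk, hak, hkl, -, h1, h2, h3⟩
    refine ⟨a, b, k, l, hb, hbk, hkl, fun s => ?_⟩
    fin_cases s
    · exact h1
    · exact h2
    · exact h3

end VincularPattern

theorem mainTheorem9 :
    VincularPattern.WilfEquiv VincularPattern.p31_2_4 VincularPattern.p13_2_4 ∧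
    VincularPattern.WilfEquiv VincularPattern.p14_2_3 VincularPattern.p41_2_3 := by
  refine ⟨fun n => ?_, fun n => ?_⟩
  · simp only [VincularPattern.avoiders, VincularPattern.containedIn_p31_2_4_iff,
      VincularPattern.containedIn_p13_2_4_iff, not_exists]
    exact (ncard_not_startsAt separable_below).symm
  · simp only [VincularPattern.avoiders, VincularPattern.containedIn_p14_2_3_iff,
      VincularPattern.containedIn_p41_2_3_iff, not_exists]
    exact ncard_not_startsAt separable_between
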